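/- Let $0<P_{bit}<\frac12$ and let $n\ge 1$ be an integer. For an integer $0\le d\le n$ put $\lambda=d/n$ and $$P_{FA}(d)=\mathbb P\Big[\sum_{i=1}^n u_i\le d\Big],\qquad P_{MD}(d)=\mathbb P\Big[\sum_{i=1}^n v_i> d\Big],$$ where $u_1,\dots,u_n$ are i.i.d. uniform on $\{0,1\}$ and $v_1,\dots,v_n$ are i.i.d. on $\{0,1\}$ with $\mathbb P[v_i=1]=P_{bit}$ (these are the false alarm and missed detection probabilities of the binary symmetric channel with crossover probability $P_{bit}$). Let $h(x)=-x\log_2x-(1-x)\log_2(1-x)$, $\delta_0=\ln\frac{1-P_{bit}}{P_{bit}}$, $q_n(d;\epsilon)=\binom nd(1-\epsilon)^{n-d}\epsilon^d$, $$g_0(\lambda,q)=\sqrt{\frac{1-\lambda}{\lambda}}\;\frac1{1-\lambda(e^q+1)},\qquad g_2(\lambda,q)=\frac{1-\lambda+\lambda^2}{12\lambda(1-\lambda)}+\frac{\lambda e^q(1+e^q)}{(1-\lambda(1+e^q))^2}.$$ For $\lambda=d/n\in(P_{bit},\frac12)$ define the one-term approximations by $$\tfrac1n\ln P^{(1)}_{FA}(d)=[h(\lambda)-1]\ln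 2-\tfrac1{2n}\ln\frac{2\pi n}{g_0^2(\lambda,0)},$$ $$\tfrac1n\ln P^{(1)}_{MD}(d)=h(\lambda)\ln2+\lambda\ln P_{bit}+(1-\lambda)\ln(1-P_{bit})-\tfrac1{2n}\ln\frac{2\pi n}{g_0^2(\lambda,\delta_0)},$$ and the two-term approximations by $P^{(2)}_{FA}(d)=P^{(1)}_{FA}(d)\big(1-\frac1ng_2(\lambda,0)\big)$ and $P^{(2)}_{MD}(d)=P^{(1)}_{MD}(d)\big(1-\frac1ng_2(\lambda,\delta_0)\big)$. For $P_e\in[0,1)$ the meta-converse rate bound is $\overline R=-\frac1n\log_2\big(P_{FA}(d)-\zeta q_n(d;\frac12)\big)$, where the integer $0\le d\le n$ and the real $0\le\zeta<1$ satisfy $P_e=P_{MD}(d)+\zeta q_n(d;P_{bit})$. For $R\ge0$ the meta-converse error bound is $\underline P_e=P_{MD}(d)+\zeta q_n(d;P_{bit})$, where $0\le d\le n$ and $0\le\zeta<1$ satisfy $P_{FA}(d)-\zeta q_n(d;\frac12)=2^{-nR}$. For $K\in\{1,2\}$, $\overline R^{(K)}$ and $\underline P_e^{(K)}$ denote any values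 obtained from the same relations with $P_{FA},P_{MD}$ replaced by $P^{(K)}_{FA},P^{(K)}_{MD}$, for an integer $d$ with $d/n\in(P_{bit},\frac12)$ and a real $0\le\zeta<1$ that satisfy the corresponding constraint (with $-\log_2 x=+\infty$ for $x\le0$). Then: 1. for every integer $d$ with $d/n\in(P_{bit},\frac12)$, $P^{(2)}_{FA}(d)\le P_{FA}(d)\le P^{(1)}_{FA}(d)$ and $P^{(2)}_{MD}(d)\le P_{MD}(d)\le P^{(1)}_{MD}(d)$; 2. for every $P_e\in[0,1)$, $\overline R$ is well defined (it exists and is unique), and $\overline R^{(1)}\le\overline R\le\overline R^{(2)}$, each inequality holding for every value $\overline R^{(1)}$, respectively $\overline R^{(2)}$, as above; 3. for every $R\ge0$, $\underline P_e$ is well defined (it exists and is unique), and $\underline P_e^{(2)}\le\underline P_e\le\underline P_e^{(1)}$, each inequality holding for every value $\underline P_e^{(2)}$, respectively $\underline P_e^{(1)}$, as above. -/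

import Mathlib

noncomputable section

namespace BSC

/-- The crossover probability `1/2` of a fair bit. -/
def fair : unitInterval := ⟨1 / 2, by norm_num, by norm_num⟩

/-- The law of `n` independent bits, each equal to `1` with probability `ε` and to `0`
with probability `1 - ε`. -/
def bitLaw (n : ℕ) (ε : unitInterval) : MeasureTheory.Measure (Fin n → ℕ) :=
  MeasureTheory.Measure.pi fun _ => ProbabilityTheory.bernoulliMeasure 1 0 ε

/-- False alarm probability: a sum of `n` independent fair bits is at most `d`. -/
def pFA (n d : ℕ) : ℝ := (bitLaw n fair).real {u | ∑ i, u i ≤ d}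

/-- Missed detection probability: a sum of `n` independent bits of parameter `P` exceeds `d`. -/
def pMD (n : ℕ) (P : unitInterval) (d : ℕ) : ℝ := (bitLaw n P).real {v | d < ∑ i, v i}

/-- The binomial weight `q_n(d; ε)`. -/
def binWeight (n d : ℕ) (ε : ℝ) : ℝ := (n.choose d : ℝ) * (1 - ε) ^ (n - d) * ε ^ d

/-- Binary entropy, in bits. -/
def entropy (x : ℝ) : ℝ := -x * Real.logb 2 x - (1 - x) * Real.logb 2 (1 - x)

/-- `δ₀ = ln ((1 - P) / P)`. -/
def delta0 (P : ℝ) : ℝ := Real.log ((1 - P) / P)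

/-- The normalized threshold `λ = d / n`. -/
def lam (n d : ℕ) : ℝ := (d : ℝ) / (n : ℝ)

/-- The first coefficient `g₀(λ, q)`. -/
def g0 (l q : ℝ) : ℝ := Real.sqrt ((1 - l) / l) * (1 / (1 - l * (Real.exp q + 1)))

/-- The second coefficient `g₂(λ, q)`. -/
def g2 (l q : ℝ) : ℝ :=
  (1 - l + l ^ 2) / (12 * l * (1 - l)) +
    l * Real.exp q * (1 + Real.exp q) / (1 - l * (1 + Real.exp q)) ^ 2

/-- One-term approximation of the false alarm probability, given through `(1/n) ln`. -/
def pFA1 (n d : ℕ) : ℝ :=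
  Real.exp (n * ((entropy (lam n d) - 1) * Real.log 2 -
    1 / (2 * n) * Real.log (2 * Real.pi * n / g0 (lam n d) 0 ^ 2)))

/-- One-term approximation of the missed detection probability, given through `(1/n) ln`. -/
def pMD1 (n : ℕ) (P : unitInterval) (d : ℕ) : ℝ :=
  Real.exp (n * (entropy (lam n d) * Real.log 2 + lam n d * Real.log P +
    (1 - lam n d) * Real.log (1 - P) -
    1 / (2 * n) * Real.log (2 * Real.pi * n / g0 (lam n d) (delta0 P) ^ 2)))

/-- Two-term approximation of the false alarm probability. The relation
`ln P⁽²⁾ = ln P⁽¹⁾ + ln (1 - g₂ / n)` is written multiplicatively, so that it also has a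
(nonpositive) value when `n ≤ g₂`. -/
def pFA2 (n d : ℕ) : ℝ := pFA1 n d * (1 - 1 / n * g2 (lam n d) 0)

/-- Two-term approximation of the missed detection probability. -/
def pMD2 (n : ℕ) (P : unitInterval) (d : ℕ) : ℝ :=
  pMD1 n P d * (1 - 1 / n * g2 (lam n d) (delta0 P))

/-- The thresholds `d` with `λ = d / n` in `(P, 1/2)`, where the approximations are used. -/
def saddleRange (n : ℕ) (P : unitInterval) : Set ℕ := {d | (P : ℝ) < lam n d ∧ lam n d < 1 / 2}

/-- `-(1/n) log₂ x`, equal to `+∞` when `x ≤ 0`. -/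
def negLogRate (n : ℕ) (x : ℝ) : EReal :=
  if 0 < x then ((-(1 / n) * Real.logb 2 x : ℝ) : EReal) else ⊤

/-- `Rbar` is a value of the meta-converse rate bound at error probability `Pe` obtained from
the false alarm and missed detection functions `FA`, `MD` with thresholds in `D`:
`Rbar = -(1/n) log₂ (FA d - ζ q_n(d; 1/2))`, where `d ∈ D` and `0 ≤ ζ < 1` satisfy
`Pe = MD d + ζ q_n(d; P)`. -/
def IsRateBound (n : ℕ) (P : unitInterval) (FA MD : ℕ → ℝ) (D : Set ℕ) (Pe : ℝ)
    (Rbar : EReal) : Prop :=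
  ∃ d ∈ D, ∃ ζ : ℝ, 0 ≤ ζ ∧ ζ < 1 ∧ Pe = MD d + ζ * binWeight n d P ∧
    Rbar = negLogRate n (FA d - ζ * binWeight n d (1 / 2))

/-- `Pe` is a value of the meta-converse error probability bound at rate `R` obtained from
`FA`, `MD` with thresholds in `D`: `Pe = MD d + ζ q_n(d; P)`, where `d ∈ D` and `0 ≤ ζ < 1`
satisfy `FA d - ζ q_n(d; 1/2) = 2 ^ (-n R)`. -/
def IsErrorBound (n : ℕ) (P : unitInterval) (FA MD : ℕ → ℝ) (D : Set ℕ) (R : ℝ)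
    (Pe : ℝ) : Prop :=
  ∃ d ∈ D, ∃ ζ : ℝ, 0 ≤ ζ ∧ ζ < 1 ∧
    FA d - ζ * binWeight n d (1 / 2) = (2 : ℝ) ^ (-(n * R)) ∧
    Pe = MD d + ζ * binWeight n d P

end BSC

end

/-! ### The number of ones among independent bits is binomial. -/

namespace BSC
open MeasureTheory ProbabilityTheory

/-! Both error probabilities are binomial tails. The relation `binWeight_succ_mul` between
consecutive weights makes the first moment of a tail about the mean telescope to a multiple of the
weight at `d`. Hence (distance of `d` from the mean) · tail + M = `(n - d) * ε * q_n(d; ε)`, where M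
≥ 0 is the first moment of the tail about `d` (`lower_tail_identity`, `upper_tail_identity`).
Dropping M bounds the tail above; bounding M by a geometric series bounds it below.

Stirling's formula with monotone remainder brackets the binomial coefficient (`choose_le_exp`,
`exp_le_choose`). The one-term approximation is exactly the upper tail bound with the coefficient
replaced by its leading Stirling term, and `g2 / n` is exactly the Stirling error plus the
geometric-series error, so part 1 follows.

For parts 2 and 3, a randomized test `(d, ζ)` sits at position `d - ζ`. Along this position the
false alarm probability strictly increases and the missed detection probability strictly decreases.
An approximate solution `(d', ζ')` is also an exact test, with one error bounded through part 1;
monotonicity (`interpolate_le_of_le`) compares it with the exact solution, and part 1 then bounds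
the other error. -/

instance (n : ℕ) (ε : unitInterval) : IsProbabilityMeasure (bitLaw n ε) := by
  unfold bitLaw; infer_instance

lemma binWeight_zero_right (n : ℕ) (ε : ℝ) : binWeight n 0 ε = (1 - ε) ^ n := by
  simp [binWeight]

lemma binWeight_eq_zero {n k : ℕ} (h : n < k) (ε : ℝ) : binWeight n k ε = 0 := by
  simp [binWeight, Nat.choose_eq_zero_of_lt h]

lemma binWeight_nonneg (n k : ℕ) {ε : ℝ} (h0 : 0 ≤ ε) (h1 : ε ≤ 1) : 0 ≤ binWeight n k ε := by
  have : 0 ≤ 1 - ε := by linarith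
  unfold binWeight; positivity

lemma binWeight_pos {n k : ℕ} (hk : k ≤ n) {ε : ℝ} (h0 : 0 < ε) (h1 : ε < 1) :
    0 < binWeight n k ε := by
  have : 0 < 1 - ε := by linarith
  have := Nat.choose_pos hk
  unfold binWeight; positivity

/-- Pascal's rule for binomial weights. -/
lemma binWeight_succ_succ (n k : ℕ) (ε : ℝ) :
    binWeight (n + 1) (k + 1) ε = ε * binWeight n k ε + (1 - ε) * binWeight n (k + 1) ε := by
  unfold binWeight
  rw [Nat.choose_succ_succ, Nat.succ_eq_add_one, Nat.add_sub_add_right]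
  rcases lt_or_ge k n with h | h
  · obtain ⟨m, rfl⟩ := Nat.exists_eq_add_of_lt h
    have e1 : k + m + 1 - k = m + 1 := by omega
    have e2 : k + m + 1 - (k + 1) = m := by omega
    rw [e1, e2]; push_cast; ring
  · rw [Nat.choose_eq_zero_of_lt (by omega : n < k + 1)]; push_cast; ring

lemma sum_binWeight (n : ℕ) (ε : ℝ) : ∑ k ∈ Finset.range (n + 1), binWeight n k ε = 1 := by
  have h := add_pow ε (1 - ε) n
  rw [add_sub_cancel, one_pow] at h
  rw [h]
  exact Finset.sum_congr rfl fun k _ => by unfold binWeight; ring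

/-- Conditioning the bits on the first one. -/
lemma bitLaw_succ_real (n : ℕ) (ε : unitInterval) (s : Set ℕ) :
    (bitLaw (n + 1) ε).real {u | ∑ i, u i ∈ s} =
      ε * (bitLaw n ε).real {u | 1 + ∑ i, u i ∈ s} +
        (1 - ε) * (bitLaw n ε).real {u | ∑ i, u i ∈ s} := by
  have hm : ∀ m : ℕ, Measurable fun u : Fin m → ℕ => ∑ i, u i := fun m => by fun_prop
  have h := measurePreserving_piFinSuccAbove
    (fun _ : Fin (n + 1) => bernoulliMeasure 1 0 ε) 0
  have hs : MeasurableSet {x : ℕ × (Fin n → ℕ) | x.1 + ∑ i, x.2 i ∈ s} :=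
    (measurable_fst.add ((hm n).comp measurable_snd)) (MeasurableSet.of_discrete (s := s))
  have key : bitLaw (n + 1) ε {u | ∑ i, u i ∈ s} =
      unitInterval.toNNReal ε * bitLaw n ε {u | 1 + ∑ i, u i ∈ s} +
        unitInterval.toNNReal (unitInterval.symm ε) * bitLaw n ε {u | ∑ i, u i ∈ s} := by
    have e : {u : Fin (n + 1) → ℕ | ∑ i, u i ∈ s} =
        (MeasurableEquiv.piFinSuccAbove (fun _ => ℕ) 0) ⁻¹'
          {x : ℕ × (Fin n → ℕ) | x.1 + ∑ i, x.2 i ∈ s} := by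
      ext u
      simp [Fin.sum_univ_succ, MeasurableEquiv.piFinSuccAbove, Fin.tail]
    rw [e, bitLaw, h.measure_preimage hs.nullMeasurableSet, Measure.prod_apply hs]
    change ∫⁻ x, bitLaw n ε (Prod.mk x ⁻¹' _) ∂_ = _
    -- The first bit's law is a combination of two Dirac masses, so the integral over sections has
    -- just two terms.
    rw [bernoulliMeasure_def, lintegral_add_measure, lintegral_smul_measure,
      lintegral_smul_measure, lintegral_dirac, lintegral_dirac, ENNReal.smul_def,
      ENNReal.smul_def, smul_eq_mul, smul_eq_mul]
    simp only [Set.preimage_ofPred_eq, zero_add]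
  rw [measureReal_def, key, ENNReal.toReal_add (by finiteness) (by finiteness)]
  simp [measureReal_def]

/-- Conditioning on the first bit gives the point masses the same recursion in `n` as Pascal's rule
gives the weights. -/
lemma bitLaw_sum_eq (n : ℕ) (ε : unitInterval) (k : ℕ) :
    (bitLaw n ε).real {u | ∑ i, u i ∈ ({k} : Set ℕ)} = binWeight n k ε := by
  induction n generalizing k with
  | zero =>
    rcases k with _ | k
    · simp [binWeight]
    · simp [binWeight]
  | succ n ih =>
    rw [bitLaw_succ_real, ih]
    rcases k with _ | k
    · simp [binWeight_zero_right]; ring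
    · have : {u : Fin n → ℕ | 1 + ∑ i, u i ∈ ({k + 1} : Set ℕ)} =
          {u | ∑ i, u i ∈ ({k} : Set ℕ)} := by
        ext u; simp [add_comm 1]
      rw [this, ih, binWeight_succ_succ]

/-- The number of ones among independent bits has the binomial law. -/
lemma bitLaw_sum_le (n : ℕ) (ε : unitInterval) (d : ℕ) :
    (bitLaw n ε).real {u | ∑ i, u i ≤ d} = ∑ k ∈ Finset.range (d + 1), binWeight n k ε := by
  have hm : Measurable fun u : Fin n → ℕ => ∑ i, u i := by fun_prop
  simp only [← bitLaw_sum_eq]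
  rw [← measureReal_biUnion_finset]
  · congr 1; ext u; simp
  · intro i _ j _ hij
    rw [Function.onFun, Set.disjoint_left]
    intro u hu hv
    exact hij (by simp at hu hv; omega)
  · intro k _
    exact hm (MeasurableSet.of_discrete (s := {k}))

lemma pFA_eq (n d : ℕ) : pFA n d = ∑ k ∈ Finset.range (d + 1), binWeight n k (1 / 2) := by
  exact bitLaw_sum_le n fair d

lemma pMD_eq (n : ℕ) (P : unitInterval) (d : ℕ) :
    pMD n P d = 1 - ∑ k ∈ Finset.range (d + 1), binWeight n k P := by
  have hm : Measurable fun u : Fin n → ℕ => ∑ i, u i := by fun_prop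
  have hs : MeasurableSet {u : Fin n → ℕ | ∑ i, u i ≤ d} :=
    hm (MeasurableSet.of_discrete (s := Set.Iic d))
  rw [← bitLaw_sum_le, ← probReal_compl_eq_one_sub hs]
  simp [pMD, Set.compl_def]

/-- The upper tail of the binomial law as a sum starting at the threshold. -/
lemma pMD_eq_sum {n d : ℕ} (P : unitInterval) (hd : d ≤ n) :
    pMD n P d = ∑ j ∈ Finset.range (n - d + 1), binWeight n (d + j) P - binWeight n d P := by
  have h := sum_binWeight n P
  have e : n + 1 = d + (n - d + 1) := by omega
  rw [e, Finset.sum_range_add] at h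
  rw [pMD_eq, Finset.sum_range_succ]
  linarith

end BSC

/-! ### Binomial tails bounded by the weight at the threshold. -/

namespace BSC

/-- A finite sequence with ratios at most `r < 1` has first moment at most that of the geometric
sequence. -/
lemma sum_mul_le_of_ratio_le {a : ℕ → ℝ} {r : ℝ} {N : ℕ} (ha : 0 ≤ a 0) (hr0 : 0 ≤ r)
    (hr1 : r < 1) (h : ∀ j, j + 1 < N → a (j + 1) ≤ r * a j) :
    ∑ j ∈ Finset.range N, (j : ℝ) * a j ≤ a 0 * (r / (1 - r) ^ 2) := by
  have hg : ∀ j, j < N → a j ≤ a 0 * r ^ j := by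
    intro j
    induction j with
    | zero => simp
    | succ j ih =>
      intro hj
      calc a (j + 1) ≤ r * a j := h j hj
        _ ≤ r * (a 0 * r ^ j) := by gcongr; exact ih (by omega)
        _ = a 0 * r ^ (j + 1) := by ring
  have hs := hasSum_coe_mul_geometric_of_norm_lt_one (r := r)
    (by rwa [Real.norm_of_nonneg hr0])
  calc ∑ j ∈ Finset.range N, (j : ℝ) * a j
      ≤ ∑ j ∈ Finset.range N, a 0 * ((j : ℝ) * r ^ j) := by
        refine Finset.sum_le_sum fun j hj => ?_
        have := mul_le_mul_of_nonneg_left (hg j (Finset.mem_range.1 hj)) (Nat.cast_nonneg (α := ℝ) j)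
        linarith
    _ = a 0 * ∑ j ∈ Finset.range N, (j : ℝ) * r ^ j := by rw [Finset.mul_sum]
    _ ≤ a 0 * (r / (1 - r) ^ 2) := by
        gcongr
        exact sum_le_hasSum _ (fun j _ => by positivity) hs

/-- The ratio of consecutive binomial weights. -/
lemma binWeight_succ_mul (n k : ℕ) (ε : ℝ) :
    ((k : ℝ) + 1) * (1 - ε) * binWeight n (k + 1) ε = (n - k) * ε * binWeight n k ε := by
  rcases lt_trichotomy k n with h | rfl | h
  · obtain ⟨m, rfl⟩ := Nat.exists_eq_add_of_lt h
    have e1 : k + m + 1 - k = m + 1 := by omega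
    have e2 : k + m + 1 - (k + 1) = m := by omega
    have hc : (((k + m + 1).choose (k + 1) : ℕ) : ℝ) * (k + 1) = (k + m + 1).choose k * (m + 1) := by
      have := Nat.choose_succ_right_eq (k + m + 1) k
      rw [e1] at this
      exact_mod_cast this
    unfold binWeight
    rw [e1, e2]; push_cast
    linear_combination (1 - ε) ^ (m + 1) * ε ^ (k + 1) * hc
  · rw [binWeight_eq_zero (by omega)]; ring
  · rw [binWeight_eq_zero h, binWeight_eq_zero (by omega)]; ring

/-- Telescoped first moment of the lower tail. -/
lemma sum_range_sub_mul_binWeight (n d : ℕ) (ε : ℝ) :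
    ∑ k ∈ Finset.range (d + 1), (n * ε - k) * binWeight n k ε = (n - d) * ε * binWeight n d ε := by
  induction d with
  | zero => simp
  | succ d ih =>
    rw [Finset.sum_range_succ, ih, ← binWeight_succ_mul]
    push_cast; ring

/-- Lower-tail identity: the tail mass and the first moment below the threshold. -/
lemma lower_tail_identity (n d : ℕ) (ε : ℝ) :
    (n * ε - d) * ∑ k ∈ Finset.range (d + 1), binWeight n k ε +
      ∑ j ∈ Finset.range (d + 1), (j : ℝ) * binWeight n (d - j) ε =
    (n - d) * ε * binWeight n d ε := by
  rw [← sum_range_sub_mul_binWeight,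
    ← Finset.sum_range_reflect (fun j => (j : ℝ) * binWeight n (d - j) ε), Finset.mul_sum,
    ← Finset.sum_add_distrib]
  refine Finset.sum_congr rfl fun k hk => ?_
  have hk : k ≤ d := by simpa [Nat.lt_succ_iff] using hk
  have e : d + 1 - 1 - k = d - k := by omega
  rw [e, Nat.sub_sub_self hk, Nat.cast_sub hk]
  ring

/-- Upper-tail identity: the tail mass and the first moment above the threshold. -/
lemma upper_tail_identity {n d : ℕ} (P : unitInterval) (hd : d ≤ n) :
    (d - n * (P : ℝ)) * pMD n P d +
      ∑ j ∈ Finset.range (n - d + 1), (j : ℝ) * binWeight n (d + j) P =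
    (n - d) * (P : ℝ) * binWeight n d P := by
  have key : ∀ N : ℕ, ∑ j ∈ Finset.range N, ((d + j : ℕ) - n * (P : ℝ)) * binWeight n (d + j) P =
      d * (1 - P) * binWeight n d P - (d + N : ℕ) * (1 - P) * binWeight n (d + N) P := by
    intro N
    induction N with
    | zero => simp
    | succ N ih =>
      rw [Finset.sum_range_succ, ih]
      have := binWeight_succ_mul n (d + N) P
      push_cast at this ⊢
      rw [← add_assoc d N 1]
      linear_combination this
  have h := key (n - d + 1)
  -- The sum runs up to `n`, so the far boundary term of the telescoping is the weight at `n + 1`,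
  -- which vanishes.
  rw [binWeight_eq_zero (k := d + (n - d + 1)) (by omega)] at h
  rw [pMD_eq_sum P hd, mul_sub, Finset.mul_sum]
  have e : ∑ j ∈ Finset.range (n - d + 1), ((d + j : ℕ) - n * (P : ℝ)) * binWeight n (d + j) P =
      ∑ j ∈ Finset.range (n - d + 1), (d - n * (P : ℝ)) * binWeight n (d + j) P +
      ∑ j ∈ Finset.range (n - d + 1), (j : ℝ) * binWeight n (d + j) P := by
    rw [← Finset.sum_add_distrib]
    exact Finset.sum_congr rfl fun j _ => by push_cast; ring
  linarith

lemma pFA_le {n d : ℕ} (hd : (2 * d : ℝ) < n) :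
    pFA n d ≤ binWeight n d (1 / 2) * ((n - d) / (n - 2 * d)) := by
  have h := lower_tail_identity n d (1 / 2)
  rw [← pFA_eq] at h
  have hM : 0 ≤ ∑ j ∈ Finset.range (d + 1), (j : ℝ) * binWeight n (d - j) (1 / 2) :=
    Finset.sum_nonneg fun j _ =>
      mul_nonneg (Nat.cast_nonneg j) (binWeight_nonneg n _ (by norm_num) (by norm_num))
  rw [mul_div_assoc', le_div_iff₀ (by linarith)]
  linarith

/-- Going down from `d`, the weights decay at least geometrically, so the first moment dropped in
`pFA_le` costs at most the relative error `2d / (n - 2d)²`. -/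
lemma le_pFA {n d : ℕ} (hd : (2 * d : ℝ) < n) :
    binWeight n d (1 / 2) * ((n - d) / (n - 2 * d)) * (1 - 2 * d / (n - 2 * d) ^ 2) ≤ pFA n d := by
  have h := lower_tail_identity n d (1 / 2)
  rw [← pFA_eq] at h
  have hd0 : (0 : ℝ) ≤ d := Nat.cast_nonneg d
  have h1 : (0 : ℝ) < n - d := by linarith
  have h2 : (0 : ℝ) < n - 2 * d := by linarith
  -- The true ratio is `(d - j) / (n - d + j + 1)`. The slightly larger `d / (n - d)` is uniform in
  -- `j` and yields exactly the second summand of `g2 / n`.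
  have hM := sum_mul_le_of_ratio_le (a := fun j => binWeight n (d - j) (1 / 2))
    (r := d / (n - d)) (N := d + 1) (binWeight_nonneg n _ (by norm_num) (by norm_num))
    (by positivity) (by rw [div_lt_one h1]; linarith) (by
      intro j hj
      obtain ⟨m, rfl⟩ := Nat.exists_eq_add_of_lt (show j < d by omega)
      have e1 : j + m + 1 - (j + 1) = m := by omega
      have e2 : j + m + 1 - j = m + 1 := by omega
      have h0 := binWeight_succ_mul n m (1 / 2)
      have hw := binWeight_nonneg n (m + 1) (ε := 1 / 2) (by norm_num) (by norm_num)
      have hw' := binWeight_nonneg n m (ε := 1 / 2) (by norm_num) (by norm_num)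
      simp only [e1, e2]
      push_cast at h1 ⊢
      rw [div_mul_eq_mul_div, le_div_iff₀ h1]
      nlinarith [mul_nonneg (Nat.cast_nonneg (α := ℝ) j) hw,
        mul_nonneg (Nat.cast_nonneg (α := ℝ) j) hw'])
  simp only [Nat.sub_zero] at hM
  have e : (d / (n - d) : ℝ) / (1 - d / (n - d)) ^ 2 = d * (n - d) / (n - 2 * d) ^ 2 := by
    have : (1 - d / (n - d) : ℝ) = (n - 2 * d) / (n - d) := by field_simp; ring
    rw [this]; field_simp
  rw [e] at hM
  have e2 : binWeight n d (1 / 2) * ((n - d) / (n - 2 * d)) * (1 - 2 * d / (n - 2 * d) ^ 2) =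
      ((n - d) * (1 / 2) * binWeight n d (1 / 2) -
        binWeight n d (1 / 2) * (d * (n - d) / (n - 2 * d) ^ 2)) / (n * (1 / 2) - d) := by
    have : (n * (1 / 2) - d : ℝ) = (n - 2 * d) / 2 := by ring
    rw [this]; field_simp
  rw [e2, div_le_iff₀ (by linarith)]
  linarith

lemma pMD_le {n d : ℕ} (P : unitInterval) (hdn : d ≤ n) (hd : n * (P : ℝ) < d) :
    pMD n P d ≤ binWeight n d P * ((n - d) * P / (d - n * P)) := by
  have h := upper_tail_identity P hdn
  have hM : 0 ≤ ∑ j ∈ Finset.range (n - d + 1), (j : ℝ) * binWeight n (d + j) P :=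
    Finset.sum_nonneg fun j _ =>
      mul_nonneg (Nat.cast_nonneg j) (binWeight_nonneg n _ P.2.1 P.2.2)
  rw [mul_div_assoc', le_div_iff₀ (by linarith)]
  linarith

lemma le_pMD {n d : ℕ} (P : unitInterval) (hP0 : 0 < (P : ℝ)) (hP1 : (P : ℝ) < 1)
    (hdn : d ≤ n) (hd : n * (P : ℝ) < d) :
    binWeight n d P * ((n - d) * P / (d - n * P)) * (1 - d * (1 - P) / (d - n * P) ^ 2) ≤
      pMD n P d := by
  have h := upper_tail_identity P hdn
  have hdn' : (0 : ℝ) ≤ n - d := by simpa using hdn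
  have hnP : 0 ≤ n * (P : ℝ) := by positivity
  have hd0 : (0 : ℝ) < d := by linarith
  have hQ : 0 < 1 - (P : ℝ) := by linarith
  have h2 : (0 : ℝ) < d - n * P := by linarith
  have hdQ : 0 < d * (1 - (P : ℝ)) := by positivity
  -- The true ratio is `(n - d - j) P / ((d + j + 1) (1 - P))`; discarding `j` and the `+ 1` gives
  -- the uniform bound that matches `g2`.
  have hM := sum_mul_le_of_ratio_le (a := fun j => binWeight n (d + j) P)
    (r := (n - d) * P / (d * (1 - P))) (N := n - d + 1) (binWeight_nonneg n _ P.2.1 P.2.2)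
    (by positivity) (by rw [div_lt_one hdQ]; linarith) (by
      intro j hj
      have h0 := binWeight_succ_mul n (d + j) P
      have hw := binWeight_nonneg n (d + j + 1) P.2.1 P.2.2
      have hw' := binWeight_nonneg n (d + j) P.2.1 P.2.2
      have hj0 : (0 : ℝ) ≤ j := Nat.cast_nonneg j
      rw [← add_assoc, div_mul_eq_mul_div, le_div_iff₀ hdQ]
      push_cast at h0
      have t1 : 0 ≤ ((j : ℝ) + 1) * (1 - P) * binWeight n (d + j + 1) P := by positivity
      have t2 : 0 ≤ (j : ℝ) * P * binWeight n (d + j) P := by positivity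
      nlinarith)
  simp only [Nat.add_zero] at hM
  have e : ((n - d) * P / (d * (1 - P)) : ℝ) / (1 - (n - d) * P / (d * (1 - P))) ^ 2 =
      (n - d) * P * (d * (1 - P)) / (d - n * P) ^ 2 := by
    have : (1 - (n - d) * P / (d * (1 - P)) : ℝ) = (d - n * P) / (d * (1 - P)) := by
      field_simp; ring
    rw [this]; field_simp
  rw [e] at hM
  have e2 : binWeight n d P * ((n - d) * P / (d - n * P)) * (1 - d * (1 - P) / (d - n * P) ^ 2) =
      ((n - d) * P * binWeight n d P -
        binWeight n d P * ((n - d) * P * (d * (1 - P)) / (d - n * P) ^ 2)) / (d - n * P) := by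
    field_simp
  rw [e2, div_le_iff₀ h2]
  linarith

end BSC

/-! ### Stirling bounds for binomial coefficients. -/

namespace BSC
open Filter Topology

/-- The logarithmic remainder in Stirling's formula. -/
noncomputable def stirlingRem (m : ℕ) : ℝ := Real.log (Stirling.stirlingSeq m) - Real.log (Real.sqrt Real.pi)

lemma log_factorial_eq {m : ℕ} (hm : m ≠ 0) :
    Real.log (m.factorial) = m * Real.log m - m + Real.log m / 2 + Real.log (2 * Real.pi) / 2 +
      stirlingRem m := by
  have h := Stirling.log_stirlingSeq_formula m
  have hm' : (m : ℝ) ≠ 0 := by exact_mod_cast hm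
  rw [Real.log_div hm' (Real.exp_ne_zero _), Real.log_exp, Real.log_mul two_ne_zero hm'] at h
  rw [stirlingRem, h, Real.log_mul two_ne_zero Real.pi_ne_zero, Real.log_sqrt Real.pi_pos.le]
  ring

lemma tendsto_stirlingRem : Tendsto stirlingRem atTop (𝓝 0) := by
  have hpi : Real.sqrt Real.pi ≠ 0 := by positivity
  have := ((Real.continuousAt_log hpi).tendsto.comp
    Stirling.tendsto_stirlingSeq_sqrt_pi).sub_const (Real.log (Real.sqrt Real.pi))
  rw [sub_self] at this
  exact this

lemma stirlingRem_antitone : Antitone fun m => stirlingRem (m + 1) := fun _ _ h =>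
  sub_le_sub_right (Stirling.log_stirlingSeq'_antitone h) _

lemma stirlingRem_nonneg {m : ℕ} (hm : m ≠ 0) : 0 ≤ stirlingRem m := by
  obtain ⟨k, rfl⟩ := Nat.exists_eq_succ_of_ne_zero hm
  exact stirlingRem_antitone.le_of_tendsto (tendsto_stirlingRem.comp (tendsto_add_atTop_nat 1)) k

/-- The remainder stays below its first asymptotic term by a decreasing amount. -/
lemma sub_stirlingRem_antitone :
    Antitone fun m : ℕ => 1 / (12 * ((m + 1 : ℕ) : ℝ)) - stirlingRem (m + 1) := by
  refine antitone_nat_of_succ_le fun m => ?_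
  have h := Stirling.log_stirlingSeq_sdiff_le (m + 1)
  -- Partial fractions turn the bound on one decrement of the remainder into a difference of
  -- consecutive values of `1 / (12 m)`.
  have e : 1 / (12 * ((m + 1 : ℕ) : ℝ) * ((m + 1 : ℕ) + 1)) =
      1 / (12 * ((m + 1 : ℕ) : ℝ)) - 1 / (12 * ((m + 1 + 1 : ℕ) : ℝ)) := by
    push_cast; field_simp; ring
  rw [e] at h
  simp only [stirlingRem]
  linarith

lemma stirlingRem_le {m : ℕ} (hm : m ≠ 0) : stirlingRem m ≤ 1 / (12 * (m : ℝ)) := by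
  obtain ⟨k, rfl⟩ := Nat.exists_eq_succ_of_ne_zero hm
  have h1 : Tendsto (fun m : ℕ => 1 / (12 * ((m + 1 : ℕ) : ℝ))) atTop (𝓝 0) := by
    have := (tendsto_one_div_add_atTop_nhds_zero_nat (𝕜 := ℝ)).const_mul (1 / 12)
    simp only [mul_zero] at this
    refine this.congr fun m => ?_
    push_cast; field_simp
  have h := sub_stirlingRem_antitone.le_of_tendsto
    (h1.sub (tendsto_stirlingRem.comp (tendsto_add_atTop_nat 1))) k
  simp only [sub_zero] at h
  exact sub_nonneg.1 h

/-- The logarithm of the leading Stirling approximation of `n.choose d`. -/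
noncomputable def logChooseApprox (n d : ℝ) : ℝ :=
  n * Real.log n - d * Real.log d - (n - d) * Real.log (n - d) +
    (Real.log n - Real.log d - Real.log (n - d) - Real.log (2 * Real.pi)) / 2

lemma log_choose_eq {n d : ℕ} (hd : d ≠ 0) (hdn : d < n) :
    Real.log (n.choose d) =
      logChooseApprox n d + (stirlingRem n - stirlingRem d - stirlingRem (n - d)) := by
  rw [Nat.cast_choose ℝ hdn.le, Real.log_div (by positivity) (by positivity),
    Real.log_mul (by positivity) (by positivity), log_factorial_eq (by omega),
    log_factorial_eq hd, log_factorial_eq (by omega), Nat.cast_sub hdn.le, logChooseApprox]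
  ring

/-- The remainder decreases to 0, so that of `n` is absorbed by that of `d`, and that of `n - d`
only helps. -/
lemma choose_le_exp {n d : ℕ} (hd : d ≠ 0) (hdn : d < n) :
    (n.choose d : ℝ) ≤ Real.exp (logChooseApprox n d) := by
  have hc : (0 : ℝ) < n.choose d := by exact_mod_cast Nat.choose_pos hdn.le
  rw [← Real.log_le_iff_le_exp hc, log_choose_eq hd hdn]
  have h1 : stirlingRem n ≤ stirlingRem d := by
    obtain ⟨k, rfl⟩ := Nat.exists_eq_succ_of_ne_zero hd
    obtain ⟨m, rfl⟩ := Nat.exists_eq_succ_of_ne_zero (show n ≠ 0 by omega)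
    exact stirlingRem_antitone (by omega)
  have h2 := stirlingRem_nonneg (m := n - d) (by omega)
  linarith

/-- Comparing `n` with `d` through the monotone gap `1 / (12 m) - stirlingRem m` keeps the term `- 1
/ (12 n)`, which the exact form of `g2` requires. The exponential of the remainders is then
linearized by `1 + x ≤ exp x`. -/
lemma exp_le_choose {n d : ℕ} (hd : d ≠ 0) (hdn : d < n) :
    Real.exp (logChooseApprox n d) *
      (1 - (1 / (12 * (d : ℝ)) + 1 / (12 * ((n : ℝ) - d)) - 1 / (12 * (n : ℝ)))) ≤
      n.choose d := by
  have hc : (0 : ℝ) < n.choose d := by exact_mod_cast Nat.choose_pos hdn.le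
  rw [← Real.exp_log hc, log_choose_eq hd hdn, Real.exp_add]
  gcongr
  have h1 : 1 / (12 * (n : ℝ)) - stirlingRem n ≤ 1 / (12 * (d : ℝ)) - stirlingRem d := by
    obtain ⟨k, rfl⟩ := Nat.exists_eq_succ_of_ne_zero hd
    obtain ⟨m, rfl⟩ := Nat.exists_eq_succ_of_ne_zero (show n ≠ 0 by omega)
    exact sub_stirlingRem_antitone (by omega)
  have h2 := stirlingRem_le (m := n - d) (by omega)
  rw [Nat.cast_sub hdn.le] at h2
  refine le_trans ?_ (Real.add_one_le_exp _)
  linarith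

end BSC

/-! ### Closed forms of the approximations, and part 1. -/

namespace BSC

lemma mul_entropy {n d : ℝ} (hd : 0 < d) (hdn : d < n) :
    n * (entropy (d / n) * Real.log 2) =
      n * Real.log n - d * Real.log d - (n - d) * Real.log (n - d) := by
  have hn : 0 < n := hd.trans hdn
  have h2 : Real.log 2 ≠ 0 := (Real.log_pos one_lt_two).ne'
  have e : 1 - d / n = (n - d) / n := by field_simp
  rw [entropy, e, Real.logb, Real.logb, Real.log_div hd.ne' hn.ne',
    Real.log_div (sub_pos.2 hdn).ne' hn.ne']
  field_simp
  ring

lemma log_two_pi_div_g0_sq {n d q : ℝ} (hd : 0 < d) (hdn : d < n)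
    (hq : 1 - d / n * (Real.exp q + 1) ≠ 0) :
    Real.log (2 * Real.pi * n / g0 (d / n) q ^ 2) =
      Real.log (2 * Real.pi) + Real.log n + Real.log d - Real.log (n - d) +
        2 * Real.log (1 - d / n * (Real.exp q + 1)) := by
  have hn : 0 < n := hd.trans hdn
  have hnd : 0 < n - d := sub_pos.2 hdn
  have e : (1 - d / n) / (d / n) = (n - d) / d := by field_simp
  have e1 : 2 * Real.pi * n / g0 (d / n) q ^ 2 =
      2 * Real.pi * n * d / (n - d) * (1 - d / n * (Real.exp q + 1)) ^ 2 := by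
    rw [g0, mul_pow, Real.sq_sqrt (by rw [e]; positivity), e]
    field_simp
  rw [e1, Real.log_mul (by positivity) (pow_ne_zero 2 hq), Real.log_pow,
    Real.log_div (by positivity) hnd.ne', Real.log_mul (by positivity) hd.ne',
    Real.log_mul (by positivity) hn.ne']
  push_cast; ring

/-- The entropy term and `g0` together reproduce the leading Stirling term; what remains is the
factor `(n - d) / (n - 2d)` of `pFA_le`. -/
lemma pFA1_eq {n d : ℕ} (hd : 0 < d) (hdn : (2 * d : ℝ) < n) :
    pFA1 n d = Real.exp (logChooseApprox n d) * ((1 - 1 / 2) ^ (n - d) * (1 / 2) ^ d) *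
      ((n - d) / (n - 2 * d)) := by
  have hd' : (0 : ℝ) < d := by exact_mod_cast hd
  have hn : (0 : ℝ) < n := by linarith
  have h1 : (0 : ℝ) < n - d := by linarith
  have h2 : (0 : ℝ) < n - 2 * d := by linarith
  have eD : 1 - (d : ℝ) / n * (Real.exp 0 + 1) = (n - 2 * d) / n := by
    rw [Real.exp_zero]; field_simp; ring
  have hle : d ≤ n := by exact_mod_cast (show (d : ℝ) ≤ n by linarith)
  have hg := log_two_pi_div_g0_sq (q := 0) hd' (show (d : ℝ) < n by linarith)
    (by rw [eD]; positivity)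
  have hh := mul_entropy hd' (show (d : ℝ) < n by linarith)
  rw [eD, Real.log_div h2.ne' hn.ne'] at hg
  have ep : ((1 - 1 / 2 : ℝ) ^ (n - d) * (1 / 2) ^ d) = Real.exp (-(n * Real.log 2)) := by
    rw [show (1 - 1 / 2 : ℝ) = 1 / 2 by norm_num, ← pow_add, Nat.sub_add_cancel hle,
      Real.exp_neg, Real.exp_nat_mul, Real.exp_log two_pos]
    simp
  rw [pFA1, lam, hg, ep, ← Real.exp_log (div_pos h1 h2), ← Real.exp_add, ← Real.exp_add,
    Real.log_div h1.ne' h2.ne', logChooseApprox]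
  congr 1
  rw [mul_sub, sub_mul, mul_sub, hh]
  field_simp
  ring

lemma one_sub_mul_exp_delta0 {P l : ℝ} (hP0 : 0 < P) (hP1 : P < 1) :
    1 - l * (Real.exp (delta0 P) + 1) = -((l - P) / P) := by
  have : 0 < 1 - P := by linarith
  rw [delta0, Real.exp_log (by positivity)]
  field_simp; ring

lemma pMD1_eq {n d : ℕ} (P : unitInterval) (hP0 : 0 < (P : ℝ)) (hP1 : (P : ℝ) < 1)
    (hdn : d < n) (hd : n * (P : ℝ) < d) :
    pMD1 n P d = Real.exp (logChooseApprox n d) * ((1 - P) ^ (n - d) * (P : ℝ) ^ d) *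
      ((n - d) * P / (d - n * P)) := by
  have hdn' : (d : ℝ) < n := by exact_mod_cast hdn
  have hQ : 0 < 1 - (P : ℝ) := by linarith
  have hnP : 0 ≤ n * (P : ℝ) := by positivity
  have hd' : (0 : ℝ) < d := by linarith
  have hn : (0 : ℝ) < n := by linarith
  have h1 : (0 : ℝ) < n - d := by linarith
  have h2 : (0 : ℝ) < d - n * P := by linarith
  have eD := one_sub_mul_exp_delta0 (l := (d : ℝ) / n) hP0 hP1
  have eD2 : ((d : ℝ) / n - P) / P = (d - n * P) / (n * P) := by field_simp
  rw [eD2] at eD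
  have hg := log_two_pi_div_g0_sq (q := delta0 P) hd' hdn'
    (by rw [eD]; exact (neg_neg_of_pos (by positivity)).ne)
  have hh := mul_entropy hd' hdn'
  -- Above `P` the denominator in `g0` is negative, but `g0` enters only squared and `Real.log` is
  -- even.
  rw [eD, Real.log_neg_eq_log, Real.log_div h2.ne' (by positivity),
    Real.log_mul hn.ne' hP0.ne'] at hg
  have ep : ((1 - P) ^ (n - d) * (P : ℝ) ^ d) =
      Real.exp ((n - d) * Real.log (1 - P) + d * Real.log P) := by
    rw [Real.exp_add, ← Nat.cast_sub hdn.le, Real.exp_nat_mul, Real.exp_nat_mul,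
      Real.exp_log hQ, Real.exp_log hP0]
  rw [pMD1, lam, hg, ep, ← Real.exp_log (div_pos (mul_pos h1 hP0) h2), ← Real.exp_add,
    ← Real.exp_add, Real.log_div (mul_pos h1 hP0).ne' h2.ne', Real.log_mul h1.ne' hP0.ne',
    logChooseApprox]
  congr 1
  rw [mul_sub, mul_add, mul_add, hh]
  field_simp
  ring

/-- Two relative errors combine additively in a lower bound for a nonnegative quantity. -/
lemma mul_one_sub_add_le {E C B S a b : ℝ} (hE : 0 ≤ E) (hB : 0 ≤ B) (ha : 0 ≤ a) (hb : 0 ≤ b)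
    (hS : 0 ≤ S) (hC : E * (1 - a) ≤ C) (h : C * B * (1 - b) ≤ S) :
    E * B * (1 - (a + b)) ≤ S := by
  -- If `b ≥ 1` the left side is nonpositive and `S ≥ 0` suffices; otherwise `1 - b` may multiply
  -- the bound on `C`.
  rcases le_or_gt 1 b with h1 | h1
  · exact le_trans (mul_nonpos_of_nonneg_of_nonpos (mul_nonneg hE hB) (by linarith)) hS
  · have hb1 : 0 ≤ 1 - b := by linarith
    calc E * B * (1 - (a + b)) ≤ E * B * (1 - (a + b)) + E * B * (a * b) := by
          have : 0 ≤ E * B * (a * b) := by positivity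
          linarith
      _ = E * (1 - a) * B * (1 - b) := by ring
      _ ≤ C * B * (1 - b) := by gcongr
      _ ≤ S := h

/-- The relative error of the leading Stirling approximation of `n.choose d`. -/
noncomputable def chooseErr (n d : ℝ) : ℝ := 1 / (12 * d) + 1 / (12 * (n - d)) - 1 / (12 * n)

lemma chooseErr_nonneg {n d : ℝ} (hd : 0 < d) (hdn : d < n) : 0 ≤ chooseErr n d := by
  have h1 : 0 < n - d := by linarith
  have h2 : 1 / (12 * n) ≤ 1 / (12 * d) := by gcongr
  have h3 : 0 < 1 / (12 * (n - d)) := by positivity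
  unfold chooseErr
  linarith

lemma inv_mul_stirling_term {n d : ℝ} (hd : 0 < d) (hdn : d < n) :
    1 / n * ((1 - d / n + (d / n) ^ 2) / (12 * (d / n) * (1 - d / n))) = chooseErr n d := by
  have h1 : 0 < n - d := by linarith
  have hn : 0 < n := by linarith
  have e : 1 - d / n = (n - d) / n := by field_simp
  rw [chooseErr, e]
  field_simp
  ring

/-- Splits the correction into the Stirling error and the tail error of `le_pFA`, the two inputs of
`mul_one_sub_add_le`. -/
lemma inv_mul_g2_zero {n d : ℝ} (hd : 0 < d) (hdn : 2 * d < n) :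
    1 / n * g2 (d / n) 0 = chooseErr n d + 2 * d / (n - 2 * d) ^ 2 := by
  have hn : 0 < n := by linarith
  have h2 : 0 < n - 2 * d := by linarith
  rw [g2, mul_add, inv_mul_stirling_term hd (by linarith), Real.exp_zero]
  have e : 1 - d / n * (1 + 1) = (n - 2 * d) / n := by field_simp; ring
  rw [e]
  field_simp
  ring

lemma inv_mul_g2_delta0 {n d P : ℝ} (hP0 : 0 < P) (hP1 : P < 1) (hdn : d < n) (hd : n * P < d)
    (hn : 0 < n) :
    1 / n * g2 (d / n) (delta0 P) = chooseErr n d + d * (1 - P) / (d - n * P) ^ 2 := by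
  have hd0 : 0 < d := (mul_pos hn hP0).trans hd
  have h2 : 0 < d - n * P := by linarith
  have hQ : 0 < 1 - P := by linarith
  have e := one_sub_mul_exp_delta0 (l := d / n) hP0 hP1
  have e2 : (d / n - P) / P = (d - n * P) / (n * P) := by field_simp
  rw [g2, mul_add, inv_mul_stirling_term hd0 hdn, add_comm 1 (Real.exp (delta0 P)), e, e2, delta0,
    Real.exp_log (by positivity)]
  field_simp
  ring

lemma saddleRange_spec {n d : ℕ} {P : unitInterval} (hn : 1 ≤ n) (hP0 : 0 < (P : ℝ))
    (h : d ∈ saddleRange n P) : 0 < d ∧ d < n ∧ (2 * d : ℝ) < n ∧ n * (P : ℝ) < d := by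
  obtain ⟨h1, h2⟩ := h
  have hn' : (0 : ℝ) < n := by exact_mod_cast hn
  unfold lam at h1 h2
  rw [lt_div_iff₀ hn'] at h1
  rw [div_lt_iff₀ hn'] at h2
  have h3 : (0 : ℝ) < P * n := by positivity
  have h4 : (0 : ℝ) < d := by linarith
  have h5 : (d : ℝ) < n := by linarith
  exact ⟨by exact_mod_cast h4, by exact_mod_cast h5, by linarith, by linarith⟩

lemma pFA_le_pFA1 {n d : ℕ} (hd : 0 < d) (hdn : (2 * d : ℝ) < n) : pFA n d ≤ pFA1 n d := by
  have hd' : (0 : ℝ) < d := by exact_mod_cast hd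
  have h1 : (0 : ℝ) < n - d := by linarith
  have h2 : (0 : ℝ) < n - 2 * d := by linarith
  have hc := choose_le_exp hd.ne' (by exact_mod_cast (show (d : ℝ) < n by linarith))
  refine (pFA_le hdn).trans ?_
  rw [pFA1_eq hd hdn, binWeight, mul_assoc (n.choose d : ℝ)]
  gcongr

lemma pFA2_le_pFA {n d : ℕ} (hd : 0 < d) (hdn : (2 * d : ℝ) < n) : pFA2 n d ≤ pFA n d := by
  have hd' : (0 : ℝ) < d := by exact_mod_cast hd
  have h1 : (0 : ℝ) < n - d := by linarith
  have h2 : (0 : ℝ) < n - 2 * d := by linarith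
  have hc := exp_le_choose hd.ne' (by exact_mod_cast (show (d : ℝ) < n by linarith))
  have hl := le_pFA hdn
  have hq : (0 : ℝ) ≤ (1 - 1 / 2) ^ (n - d) * (1 / 2) ^ d := by norm_num
  rw [binWeight, mul_assoc (n.choose d : ℝ)] at hl
  rw [pFA2, lam, inv_mul_g2_zero hd' hdn, pFA1_eq hd hdn, mul_assoc (Real.exp _)]
  refine mul_one_sub_add_le (Real.exp_pos _).le (mul_nonneg hq (by positivity))
    (chooseErr_nonneg hd' (by linarith)) (by positivity) MeasureTheory.measureReal_nonneg hc ?_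
  rwa [← mul_assoc]

lemma pMD_le_pMD1 {n d : ℕ} {P : unitInterval} (hP0 : 0 < (P : ℝ)) (hP1 : (P : ℝ) < 1)
    (hd0 : 0 < d) (hdn : d < n) (hd : n * (P : ℝ) < d) : pMD n P d ≤ pMD1 n P d := by
  have h1 : (0 : ℝ) < n - d := by simpa using hdn
  have h2 : (0 : ℝ) < d - n * P := by linarith
  have hQ : 0 < 1 - (P : ℝ) := by linarith
  have hc := choose_le_exp hd0.ne' hdn
  refine (pMD_le P hdn.le hd).trans ?_
  rw [pMD1_eq P hP0 hP1 hdn hd, binWeight, mul_assoc (n.choose d : ℝ)]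
  gcongr

lemma pMD2_le_pMD {n d : ℕ} {P : unitInterval} (hP0 : 0 < (P : ℝ)) (hP1 : (P : ℝ) < 1)
    (hd0 : 0 < d) (hdn : d < n) (hd : n * (P : ℝ) < d) : pMD2 n P d ≤ pMD n P d := by
  have hd' : (0 : ℝ) < d := by exact_mod_cast hd0
  have h1 : (0 : ℝ) < n - d := by simpa using hdn
  have h2 : (0 : ℝ) < d - n * P := by linarith
  have hQ : 0 < 1 - (P : ℝ) := by linarith
  have hc := exp_le_choose hd0.ne' hdn
  have hl := le_pMD P hP0 hP1 hdn.le hd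
  rw [binWeight, mul_assoc (n.choose d : ℝ)] at hl
  rw [pMD2, lam, inv_mul_g2_delta0 hP0 hP1 (by linarith) hd (by linarith),
    pMD1_eq P hP0 hP1 hdn hd, mul_assoc (Real.exp _)]
  refine mul_one_sub_add_le (Real.exp_pos _).le (by positivity)
    (chooseErr_nonneg hd' (by linarith)) (by positivity) MeasureTheory.measureReal_nonneg hc ?_
  rwa [← mul_assoc]

end BSC

/-! ### Randomized tests and the trade-off between the two errors. -/

namespace BSC

/-- Interpolating linearly below each value of a sequence with increments `w` is strictly
increasing in the position `d - ζ`. -/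
lemma interpolate_lt {n : ℕ} {f w : ℕ → ℝ} (hw : ∀ d ≤ n, 0 < w d)
    (hf : ∀ d < n, f (d + 1) = f d + w (d + 1)) {d d' : ℕ} {ζ ζ' : ℝ} (hd' : d' ≤ n)
    (hζ : 0 ≤ ζ) (hζ1 : ζ < 1) (hζ' : 0 ≤ ζ') (hζ1' : ζ' < 1) (h : (d : ℝ) - ζ < d' - ζ') :
    f d - ζ * w d < f d' - ζ' * w d' := by
  have hle : d ≤ d' := by
    by_contra hlt
    have : (d' : ℝ) + 1 ≤ d := by exact_mod_cast not_le.1 hlt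
    linarith
  rcases hle.eq_or_lt with rfl | hlt
  · have := hw d hd'
    have : ζ' * w d < ζ * w d := by
      apply mul_lt_mul_of_pos_right _ this
      linarith
    linarith
  -- With `d' = d + m + 1`: `f d ≤ f (d' - 1) = f d' - w d' < f d' - ζ' * w d'`, the last step
  -- because `ζ' < 1`.
  · obtain ⟨m, rfl⟩ := Nat.exists_eq_add_of_lt hlt
    have hmono : ∀ j, d + j ≤ n → f d ≤ f (d + j) := by
      intro j
      induction j with
      | zero => simp
      | succ j ih =>
        intro hj
        rw [← add_assoc, hf _ (by omega)]
        linarith [ih (by omega), hw (d + j + 1) (by omega)]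
    have h1 := hmono m (by omega)
    have h2 := hf (d + m) (by omega)
    have h3 := mul_lt_mul_of_pos_right hζ1' (hw _ hd')
    have h4 := mul_nonneg hζ (hw d (by omega)).le
    linarith

/-- The half-open range of `ζ` makes `d` the ceiling of `d - ζ`. -/
lemma position_inj {d d' : ℕ} {ζ ζ' : ℝ} (hζ : 0 ≤ ζ) (hζ1 : ζ < 1) (hζ' : 0 ≤ ζ')
    (hζ1' : ζ' < 1) (h : (d : ℝ) - ζ = d' - ζ') : d = d' ∧ ζ = ζ' := by
  have hd : d = d' := by
    have h1 : (d : ℝ) < d' + 1 := by linarith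
    have h2 : (d' : ℝ) < d + 1 := by linarith
    have h1 : d < d' + 1 := by exact_mod_cast h1
    have h2 : d' < d + 1 := by exact_mod_cast h2
    omega
  exact ⟨hd, by rw [hd] at h; linarith⟩

/-- Values of two interpolated sequences are ordered alike. -/
lemma interpolate_le_of_le {n : ℕ} {f w g v : ℕ → ℝ} (hw : ∀ d ≤ n, 0 < w d)
    (hf : ∀ d < n, f (d + 1) = f d + w (d + 1)) (hv : ∀ d ≤ n, 0 < v d)
    (hg : ∀ d < n, g (d + 1) = g d + v (d + 1)) {d d' : ℕ} {ζ ζ' : ℝ} (hd : d ≤ n)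
    (hd' : d' ≤ n) (hζ : 0 ≤ ζ) (hζ1 : ζ < 1) (hζ' : 0 ≤ ζ') (hζ1' : ζ' < 1)
    (h : f d - ζ * w d ≤ f d' - ζ' * w d') : g d - ζ * v d ≤ g d' - ζ' * v d' := by
  rcases lt_trichotomy ((d : ℝ) - ζ) (d' - ζ') with hlt | heq | hgt
  · exact (interpolate_lt hv hg hd' hζ hζ1 hζ' hζ1' hlt).le
  · obtain ⟨rfl, rfl⟩ := position_inj hζ hζ1 hζ' hζ1' heq
    exact le_rfl
  · exact absurd h (not_le.2 (interpolate_lt hw hf hd hζ' hζ1' hζ hζ1 hgt))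

/-- Take the least `d` with `y ≤ f d`. Minimality gives `f d - w d < y`, hence `ζ < 1`; at `d = 0`
there is no predecessor, and the strict hypothesis on `y` takes its place. -/
lemma exists_interpolate_eq {n : ℕ} {f w : ℕ → ℝ} (hw : ∀ d ≤ n, 0 < w d)
    (hf : ∀ d < n, f (d + 1) = f d + w (d + 1)) {y : ℝ} (hy0 : f 0 - w 0 < y) (hy : y ≤ f n) :
    ∃ d ≤ n, ∃ ζ : ℝ, 0 ≤ ζ ∧ ζ < 1 ∧ f d - ζ * w d = y := by
  have hex : ∃ d, y ≤ f d := ⟨n, hy⟩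
  classical
  have hmin := Nat.find_spec hex
  have hdn : Nat.find hex ≤ n := Nat.find_min' hex hy
  have hlow : f (Nat.find hex) - w (Nat.find hex) < y := by
    rcases Nat.eq_zero_or_pos (Nat.find hex) with h0 | h0
    · rw [h0]; exact hy0
    · obtain ⟨m, hm⟩ := Nat.exists_eq_succ_of_ne_zero h0.ne'
      have hlt := not_le.1 (Nat.find_min hex (m := m) (by omega))
      rw [hm, Nat.succ_eq_add_one, hf m (by omega)]
      linarith
  have hpos := hw _ hdn
  refine ⟨Nat.find hex, hdn, (f (Nat.find hex) - y) / w (Nat.find hex), ?_, ?_, ?_⟩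
  · exact div_nonneg (by linarith) hpos.le
  · rw [div_lt_one hpos]; linarith
  · field_simp; ring

lemma negLogRate_antitone (n : ℕ) : Antitone (negLogRate n) := by
  intro x y hxy
  unfold negLogRate
  split_ifs with hy hx hx
  · refine EReal.coe_le_coe_iff.2 ?_
    have := Real.logb_le_logb_of_le one_lt_two hx hxy
    have hn : (0 : ℝ) ≤ 1 / n := by positivity
    nlinarith
  · exact le_top
  · exact absurd (hx.trans_le hxy) hy
  · exact le_rfl

lemma pFA_succ (n d : ℕ) : pFA n (d + 1) = pFA n d + binWeight n (d + 1) (1 / 2) := by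
  rw [pFA_eq, pFA_eq, Finset.sum_range_succ _ (d + 1)]

lemma neg_pMD_succ (n : ℕ) (P : unitInterval) (d : ℕ) :
    -pMD n P (d + 1) = -pMD n P d + binWeight n (d + 1) P := by
  rw [pMD_eq, pMD_eq, Finset.sum_range_succ _ (d + 1)]; ring

/-- Along the randomized tests, missed detection decreases as false alarm increases. -/
lemma pFA_interpolate_le {n : ℕ} {P : unitInterval} (hP0 : 0 < (P : ℝ)) (hP1 : (P : ℝ) < 1)
    {d d' : ℕ} {ζ ζ' : ℝ} (hd : d ≤ n) (hd' : d' ≤ n) (hζ : 0 ≤ ζ) (hζ1 : ζ < 1) (hζ' : 0 ≤ ζ')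
    (hζ1' : ζ' < 1)
    (h : pMD n P d' + ζ' * binWeight n d' P ≤ pMD n P d + ζ * binWeight n d P) :
    pFA n d - ζ * binWeight n d (1 / 2) ≤ pFA n d' - ζ' * binWeight n d' (1 / 2) :=
  interpolate_le_of_le (f := fun d => -pMD n P d) (fun _ hk => binWeight_pos hk hP0 hP1)
    (fun k _ => neg_pMD_succ n P k) (fun _ hk => binWeight_pos hk (by norm_num) (by norm_num))
    (fun k _ => pFA_succ n k) hd hd' hζ hζ1 hζ' hζ1' (by linarith)

lemma pMD_interpolate_le {n : ℕ} {P : unitInterval} (hP0 : 0 < (P : ℝ)) (hP1 : (P : ℝ) < 1)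
    {d d' : ℕ} {ζ ζ' : ℝ} (hd : d ≤ n) (hd' : d' ≤ n) (hζ : 0 ≤ ζ) (hζ1 : ζ < 1) (hζ' : 0 ≤ ζ')
    (hζ1' : ζ' < 1)
    (h : pFA n d - ζ * binWeight n d (1 / 2) ≤ pFA n d' - ζ' * binWeight n d' (1 / 2)) :
    pMD n P d' + ζ' * binWeight n d' P ≤ pMD n P d + ζ * binWeight n d P := by
  have := interpolate_le_of_le (g := fun d => -pMD n P d)
    (fun _ hk => binWeight_pos hk (by norm_num) (by norm_num))
    (fun k _ => pFA_succ n k) (fun _ hk => binWeight_pos hk hP0 hP1)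
    (fun k _ => neg_pMD_succ n P k) hd hd' hζ hζ1 hζ' hζ1' h
  linarith

lemma existsUnique_isRateBound {n : ℕ} {P : unitInterval} (hP0 : 0 < (P : ℝ))
    (hP1 : (P : ℝ) < 1) {Pe : ℝ} (h0 : 0 ≤ Pe) (h1 : Pe < 1) :
    ∃! Rbar : EReal, IsRateBound n P (pFA n) (pMD n P) (Set.Iic n) Pe Rbar := by
  obtain ⟨d, hd, ζ, hζ, hζ1, h⟩ := exists_interpolate_eq (n := n) (f := fun d => -pMD n P d)
    (w := fun d => binWeight n d P) (y := -Pe) (fun _ hk => binWeight_pos hk hP0 hP1)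
    -- The interpolated values of `-pMD` fill `(-1, 0]`, which is why `Pe < 1` must be strict.
    (fun k _ => neg_pMD_succ n P k) (by simp [pMD_eq]; linarith)
    (by simp only [pMD_eq, sum_binWeight]; linarith)
  refine ⟨_, ⟨d, hd, ζ, hζ, hζ1, by linarith, rfl⟩, ?_⟩
  rintro _ ⟨d', hd', ζ', hζ', hζ1', h', rfl⟩
  congr 1
  exact le_antisymm (pFA_interpolate_le hP0 hP1 hd' hd hζ' hζ1' hζ hζ1 (by linarith))
    (pFA_interpolate_le hP0 hP1 hd hd' hζ hζ1 hζ' hζ1' (by linarith))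

lemma existsUnique_isErrorBound {n : ℕ} {P : unitInterval} (hP0 : 0 < (P : ℝ))
    (hP1 : (P : ℝ) < 1) {R : ℝ} (hR : 0 ≤ R) :
    ∃! Pe : ℝ, IsErrorBound n P (pFA n) (pMD n P) (Set.Iic n) R Pe := by
  obtain ⟨d, hd, ζ, hζ, hζ1, h⟩ := exists_interpolate_eq (n := n) (f := pFA n)
    (w := fun d => binWeight n d (1 / 2)) (y := (2 : ℝ) ^ (-(n * R)))
    (fun _ hk => binWeight_pos hk (by norm_num) (by norm_num))
    (fun k _ => pFA_succ n k) (by simp only [pFA_eq]; simp; positivity)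
    (by
      rw [pFA_eq, sum_binWeight]
      exact Real.rpow_le_one_of_one_le_of_nonpos one_le_two (by simp; positivity))
  refine ⟨_, ⟨d, hd, ζ, hζ, hζ1, h, rfl⟩, ?_⟩
  rintro _ ⟨d', hd', ζ', hζ', hζ1', h', rfl⟩
  exact le_antisymm (pMD_interpolate_le hP0 hP1 hd hd' hζ hζ1 hζ' hζ1' (h.trans h'.symm).le)
    (pMD_interpolate_le hP0 hP1 hd' hd hζ' hζ1' hζ hζ1 (h'.trans h.symm).le)

end BSC

/-! ### Assembly of the three parts. -/

theorem mainTheorem8 (n : ℕ) (hn : 1 ≤ n) (P : unitInterval)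
    (hP0 : 0 < (P : ℝ)) (hP : (P : ℝ) < 1 / 2) :
    (∀ d ∈ BSC.saddleRange n P,
      (BSC.pFA2 n d ≤ BSC.pFA n d ∧ BSC.pFA n d ≤ BSC.pFA1 n d) ∧
      (BSC.pMD2 n P d ≤ BSC.pMD n P d ∧ BSC.pMD n P d ≤ BSC.pMD1 n P d)) ∧
    (∀ Pe : ℝ, 0 ≤ Pe → Pe < 1 →
      (∃! Rbar : EReal, BSC.IsRateBound n P (BSC.pFA n) (BSC.pMD n P) (Set.Iic n) Pe Rbar) ∧
      ∀ Rbar : EReal, BSC.IsRateBound n P (BSC.pFA n) (BSC.pMD n P) (Set.Iic n) Pe Rbar →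
        (∀ Rbar1 : EReal,
          BSC.IsRateBound n P (BSC.pFA1 n) (BSC.pMD1 n P) (BSC.saddleRange n P) Pe Rbar1 →
            Rbar1 ≤ Rbar) ∧
        (∀ Rbar2 : EReal,
          BSC.IsRateBound n P (BSC.pFA2 n) (BSC.pMD2 n P) (BSC.saddleRange n P) Pe Rbar2 →
            Rbar ≤ Rbar2)) ∧
    (∀ R : ℝ, 0 ≤ R →
      (∃! Pe : ℝ, BSC.IsErrorBound n P (BSC.pFA n) (BSC.pMD n P) (Set.Iic n) R Pe) ∧
      ∀ Pe : ℝ, BSC.IsErrorBound n P (BSC.pFA n) (BSC.pMD n P) (Set.Iic n) R Pe →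
        (∀ Pe2 : ℝ,
          BSC.IsErrorBound n P (BSC.pFA2 n) (BSC.pMD2 n P) (BSC.saddleRange n P) R Pe2 →
            Pe2 ≤ Pe) ∧
        (∀ Pe1 : ℝ,
          BSC.IsErrorBound n P (BSC.pFA1 n) (BSC.pMD1 n P) (BSC.saddleRange n P) R Pe1 →
            Pe ≤ Pe1)) := by

  have hP1 : (P : ℝ) < 1 := by linarith
  have hFA : ∀ d ∈ BSC.saddleRange n P, BSC.pFA2 n d ≤ BSC.pFA n d ∧ BSC.pFA n d ≤ BSC.pFA1 n d :=
    fun d hd => by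
      obtain ⟨h0, -, h2, -⟩ := BSC.saddleRange_spec hn hP0 hd
      exact ⟨BSC.pFA2_le_pFA h0 h2, BSC.pFA_le_pFA1 h0 h2⟩
  have hMD : ∀ d ∈ BSC.saddleRange n P,
      BSC.pMD2 n P d ≤ BSC.pMD n P d ∧ BSC.pMD n P d ≤ BSC.pMD1 n P d :=
    fun d hd => by
      obtain ⟨h0, h1, -, h3⟩ := BSC.saddleRange_spec hn hP0 hd
      exact ⟨BSC.pMD2_le_pMD hP0 hP1 h0 h1 h3, BSC.pMD_le_pMD1 hP0 hP1 h0 h1 h3⟩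
  have hle : ∀ d ∈ BSC.saddleRange n P, d ≤ n := fun d hd =>
    (BSC.saddleRange_spec hn hP0 hd).2.1.le
  refine ⟨fun d hd => ⟨hFA d hd, hMD d hd⟩, fun Pe h0 h1 =>
    ⟨BSC.existsUnique_isRateBound hP0 hP1 h0 h1, ?_⟩, fun R hR =>
    ⟨BSC.existsUnique_isErrorBound hP0 hP1 hR, ?_⟩⟩
  · rintro _ ⟨d, hd, ζ, hζ, hζ1, h, rfl⟩
    constructor
    · rintro _ ⟨d', hd', ζ', hζ', hζ1', h', rfl⟩
      -- As an exact test, `(d', ζ')` misses with probability at most `Pe`, so its false alarm is at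
      -- least the exact one; `pFA1` only enlarges it, which lowers the rate.
      refine BSC.negLogRate_antitone n ((BSC.pFA_interpolate_le hP0 hP1 hd (hle d' hd')
        hζ hζ1 hζ' hζ1' ?_).trans (sub_le_sub_right (hFA d' hd').2 _))
      linarith [(hMD d' hd').2]
    · rintro _ ⟨d', hd', ζ', hζ', hζ1', h', rfl⟩
      refine BSC.negLogRate_antitone n ((sub_le_sub_right (hFA d' hd').1 _).trans
        (BSC.pFA_interpolate_le hP0 hP1 (hle d' hd') hd hζ' hζ1' hζ hζ1 ?_))
      linarith [(hMD d' hd').1]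
  · rintro _ ⟨d, hd, ζ, hζ, hζ1, h, rfl⟩
    constructor
    · rintro _ ⟨d', hd', ζ', hζ', hζ1', h', rfl⟩
      -- Since `pFA2 ≤ pFA`, the exact test `(d', ζ')` has false alarm at least `2 ^ (-nR)`, hence
      -- missed detection at most the exact bound.
      refine (add_le_add_left (hMD d' hd').1 _).trans
        (BSC.pMD_interpolate_le hP0 hP1 hd (hle d' hd') hζ hζ1 hζ' hζ1' ?_)
      linarith [(hFA d' hd').1]
    · rintro _ ⟨d', hd', ζ', hζ', hζ1', h', rfl⟩
      refine (BSC.pMD_interpolate_le hP0 hP1 (hle d' hd') hd hζ' hζ1' hζ hζ1 ?_).trans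
        (add_le_add_left (hMD d' hd').2 _)
      linarith [(hFA d' hd').2]
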